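/- Let $X$ be a reflexive real Banach space with dual $X^*$ and pairing $\langle\cdot,\cdot\rangle$. For a set-valued operator $A\colon X\rightrightarrows X^*$ write $\operatorname{gra}A=\{(x,x^*) : x^*\in Ax\}$ and $\operatorname{dom}A=\{x\in X : Ax\neq\varnothing\}$; sums of operators are taken pointwise, $(A+B)x=\{a+b : a\in Ax,\ b\in Bx\}$. The operator $A$ is a linear relation if $\operatorname{gra}A$ is a linear subspace of $X\times X^*$; it is monotone if $\langle x-y,x^*-y^*\rangle\ge 0$ for all $(x,x^*),(y,y^*)\in\operatorname{gra}A$, and maximal monotone if moreover no monotone operator has a graph properly containing $\operatorname{gra}A$. A linear relation $S\colon X\rightrightarrows X^*$ is skew if $\langle x,x^*\rangle=0$ for all $(x,x^*)\in\operatorname{gra}S$, and an operator $S$ is at most single-valued if every $Sx$ is empty or a singleton. For $f\colon X\to\left]-\infty,+\infty\right]$ convex, $\partial f(x)=\{x^*\in X^* : \langle y-x,x^*\rangle+f(x)\le f(y)\ \text{for all } y\in X\}$. A Borwein-Wiersma decomposition of $A$ is an identity $A=\partial f+S$ in which $f\colon X\to\left]-\infty,+\infty\right]$ is proper (not identically $+\infty$),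 lower semicontinuous and convex, and $S\colon X\rightrightarrows X^*$ is a skew linear relation that is at most single-valued. **Proposition (sum rule).** Let $A_1$ and $A_2$ be maximal monotone linear relations from $X$ to $X^*$ with Borwein-Wiersma decompositions $A_1=\partial f_1+S_1$ and $A_2=\partial f_2+S_2$. Suppose that the set $\operatorname{dom}A_1-\operatorname{dom}A_2=\{x-y : x\in\operatorname{dom}A_1,\ y\in\operatorname{dom}A_2\}$ is closed in $X$. Then $$A_1+A_2=\partial(f_1+f_2)+(S_1+S_2)$$ is a Borwein-Wiersma decomposition of $A_1+A_2$; that is, the identity holds, $f_1+f_2$ is proper, lower semicontinuous and convex, and $S_1+S_2$ is a skew linear relation that is at most single-valued. -/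

import Mathlib

open scoped Pointwise

namespace BorweinWiersma

/-- A normed space is reflexive if the canonical embedding into its double dual is onto. -/
def IsReflexiveSpace (X : Type*) [NormedAddCommGroup X] [NormedSpace ℝ X] : Prop :=
  Function.Surjective (NormedSpace.inclusionInDoubleDual ℝ X)

section

variable {X : Type*} [NormedAddCommGroup X] [NormedSpace ℝ X]

/-- The graph of a set-valued operator `A : X ⇉ X*`. Sums of set-valued operators are Mathlib's
pointwise sums: `(A + B) x = A x + B x`, the Minkowski sum of two sets in `X*`. -/
def gra (A : X → Set (StrongDual ℝ X)) : Set (X × StrongDual ℝ X) :=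
  {p | p.2 ∈ A p.1}

/-- The domain of a set-valued operator. -/
def dom (A : X → Set (StrongDual ℝ X)) : Set X :=
  {x | (A x).Nonempty}

/-- Monotone set-valued operators. -/
def IsMonotoneOp (A : X → Set (StrongDual ℝ X)) : Prop :=
  ∀ p ∈ gra A, ∀ q ∈ gra A, 0 ≤ (p.2 - q.2) (p.1 - q.1)

/-- Maximal monotone operators: monotone, with no proper monotone enlargement of the graph. -/
def IsMaximalMonotone (A : X → Set (StrongDual ℝ X)) : Prop :=
  IsMonotoneOp A ∧
    ∀ B : X → Set (StrongDual ℝ X), IsMonotoneOp B → gra A ⊆ gra B → gra B = gra A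

/-- Linear relations: the graph is a linear subspace of `X × X*`. -/
def IsLinearRelation (A : X → Set (StrongDual ℝ X)) : Prop :=
  ∃ V : Submodule ℝ (X × StrongDual ℝ X), (V : Set (X × StrongDual ℝ X)) = gra A

/-- Skew operators: linear relations with `⟨x, x*⟩ = 0` on the graph. -/
def IsSkew (S : X → Set (StrongDual ℝ X)) : Prop :=
  IsLinearRelation S ∧ ∀ p ∈ gra S, p.2 p.1 = 0

/-- At most single-valued operators. -/
def IsAtMostSingleValued (S : X → Set (StrongDual ℝ X)) : Prop :=
  ∀ x, (S x).Subsingleton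

/-- Proper lower semicontinuous convex functions `X → ]-∞, +∞]`. Since `-∞` is not a value,
the sums and products below involve no undefined expression. -/
structure IsProperLscConvex (f : X → EReal) : Prop where
  ne_bot : ∀ x, f x ≠ ⊥
  proper : ∃ x, f x < ⊤
  lsc : LowerSemicontinuous f
  convex : ∀ x y : X, ∀ a b : ℝ, 0 < a → 0 < b → a + b = 1 →
    f (a • x + b • y) ≤ (a : EReal) * f x + (b : EReal) * f y

/-- The subdifferential operator:
`∂f(x) = {x* | ⟨y - x, x*⟩ + f(x) ≤ f(y) for all y}`. -/
def subdifferential (f : X → EReal) : X → Set (StrongDual ℝ X) :=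
  fun x => {xs | ∀ y : X, ((xs (y - x) : ℝ) : EReal) + f x ≤ f y}

/-- `A = ∂f + S` is a Borwein-Wiersma decomposition of `A`. -/
structure IsBorweinWiersmaDecomposition (A : X → Set (StrongDual ℝ X)) (f : X → EReal)
    (S : X → Set (StrongDual ℝ X)) : Prop where
  properLscConvex : IsProperLscConvex f
  skew : IsSkew S
  singleValued : IsAtMostSingleValued S
  eq_add : A = subdifferential f + S

end

end BorweinWiersma

namespace BorweinWiersma

variable {X : Type*} [NormedAddCommGroup X] [NormedSpace ℝ X]

/-! The graph of `A₁ + A₂` lies in that of `∂(f₁ + f₂) + (S₁ + S₂)`, which is monotone; equality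
follows once `A₁ + A₂` contains every point monotonically related to it
(`mem_add_of_monotonically_related`). For such a point `(y, z)`, the constraint that the two graph
points share their first coordinate is removed by a Lagrange multiplier (`exists_multiplier`). The
multiplier extends to some `l` in `X*` and splits `z = (z - l) + l`; maximality of each operator
puts `z - l` in `A₁ y` and `l` in `A₂ y`. -/

theorem IsMaximalMonotone.mem_of_forall {A : X → Set (StrongDual ℝ X)} (hA : IsMaximalMonotone A)
    {y : X} {z : StrongDual ℝ X} (h : ∀ p ∈ gra A, 0 ≤ (z - p.2) (y - p.1)) : z ∈ A y := by
  have key : gra (fun x => {w | w ∈ A x ∨ (x = y ∧ w = z)}) = gra A := by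
    refine hA.2 _ ?_ (fun p hp => Or.inl hp)
    rintro ⟨a, a'⟩ (ha | ⟨rfl, rfl⟩) ⟨b, b'⟩ (hb | ⟨rfl, rfl⟩)
    · exact hA.1 (a, a') ha (b, b') hb
    · have := h (a, a') ha
      simp only [sub_apply, map_sub] at this ⊢
      linarith
    · exact h (b, b') hb
    · simp
  have : (y, z) ∈ gra (fun x => {w | w ∈ A x ∨ (x = y ∧ w = z)}) := Or.inr ⟨rfl, rfl⟩
  rwa [key] at this

theorem continuous_dual_pairing :
    Continuous fun q : X × StrongDual ℝ X => q.2 q.1 :=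
  isBoundedBilinearMap_apply.continuous.comp (continuous_snd.prodMk continuous_fst)

theorem IsMaximalMonotone.isClosed_gra {A : X → Set (StrongDual ℝ X)}
    (hA : IsMaximalMonotone A) : IsClosed (gra A) := by
  have : gra A = ⋂ p ∈ gra A, {q : X × StrongDual ℝ X | 0 ≤ (q.2 - p.2) (q.1 - p.1)} := by
    ext ⟨y, z⟩
    simp only [Set.mem_iInter, Set.mem_ofPred_eq]
    exact ⟨fun hq p hp => hA.1 _ hq p hp, fun h => hA.mem_of_forall h⟩
  rw [this]
  refine isClosed_biInter fun p _ => isClosed_le continuous_const ?_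
  exact continuous_dual_pairing.comp (continuous_id.sub continuous_const :
    Continuous fun q : X × StrongDual ℝ X => q - p)

/-- A positive lower bound would put `(y, z)` on the graph, where the pairing with itself is 0. This
decouples a sum of two pairings into separate bounds. -/
theorem IsMaximalMonotone.exists_pairing_lt {A : X → Set (StrongDual ℝ X)}
    (hA : IsMaximalMonotone A) (y : X) (z : StrongDual ℝ X) {ε : ℝ} (hε : 0 < ε) :
    ∃ p ∈ gra A, (z - p.2) (y - p.1) < ε := by
  by_contra! h
  have hz := hA.mem_of_forall fun p hp => hε.le.trans (h p hp)
  have := h (y, z) hz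
  simp at this
  linarith

/-- If the pairings with `A₁` and `A₂` have nonnegative sums, then both points lie on the graphs. -/
theorem IsMaximalMonotone.mem_and_mem_of_add_nonneg {A₁ A₂ : X → Set (StrongDual ℝ X)}
    (hA₁ : IsMaximalMonotone A₁) (hA₂ : IsMaximalMonotone A₂) {y₁ y₂ : X}
    {z₁ z₂ : StrongDual ℝ X}
    (h : ∀ p ∈ gra A₁, ∀ q ∈ gra A₂, 0 ≤ (z₁ - p.2) (y₁ - p.1) + (z₂ - q.2) (y₂ - q.1)) :
    z₁ ∈ A₁ y₁ ∧ z₂ ∈ A₂ y₂ := by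
  constructor
  · refine hA₁.mem_of_forall fun p hp => le_of_forall_pos_le_add fun ε hε => ?_
    obtain ⟨q, hq, hlt⟩ := hA₂.exists_pairing_lt y₂ z₂ hε
    linarith [h p hp q hq]
  · refine hA₂.mem_of_forall fun q hq => le_of_forall_pos_le_add fun ε hε => ?_
    obtain ⟨p, hp, hlt⟩ := hA₁.exists_pairing_lt y₁ z₁ hε
    linarith [h p hp q hq]

/-- A continuous convex function which is nonnegative on the kernel of a surjective continuous
linear map between Banach spaces becomes nonnegative after adding a multiplier. -/
theorem exists_multiplier {E F : Type*} [NormedAddCommGroup E] [NormedSpace ℝ E] [CompleteSpace E]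
    [NormedAddCommGroup F] [NormedSpace ℝ F] [CompleteSpace F] (T : E →L[ℝ] F)
    (hT : Function.Surjective T) {φ : E → ℝ} (hcont : Continuous φ)
    (hconv : ConvexOn ℝ Set.univ φ) (hnonneg : ∀ p, T p = 0 → 0 ≤ φ p) :
    ∃ μ : StrongDual ℝ F, ∀ p, 0 ≤ φ p + μ (T p) := by
  set U : Set (E × ℝ) := {p | p.1 ∈ Set.univ ∧ φ p.1 < p.2} with hU
  have hUopen : IsOpen U := by
    have : U = {p | φ p.1 < p.2} := by ext; simp [hU]
    rw [this]
    exact isOpen_lt (hcont.comp continuous_fst) continuous_snd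
  -- By the open mapping theorem the image of the strict epigraph is open, so it can be separated
  -- from the origin.
  have hopen : IsOpen (Prod.map T (id : ℝ → ℝ) '' U) :=
    ((T.isOpenMap hT).prodMap IsOpenMap.id) _ hUopen
  have hconvex : Convex ℝ (Prod.map T (id : ℝ → ℝ) '' U) :=
    hconv.convex_strict_epigraph.linear_image (T.toLinearMap.prodMap LinearMap.id)
  have hzero : (0 : F × ℝ) ∉ Prod.map T (id : ℝ → ℝ) '' U := by
    rintro ⟨⟨p, r⟩, ⟨-, hr⟩, h⟩
    simp only [Prod.map_apply, id_eq, Prod.mk_eq_zero] at h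
    have := hnonneg p h.1
    simp only at hr
    linarith [h.2]
  obtain ⟨f, hf⟩ := geometric_hahn_banach_point_open hconvex hopen hzero
  have hsplit : ∀ (d : F) (r : ℝ), f (d, r) = f (d, 0) + r * f (0, 1) := by
    intro d r
    rw [← smul_eq_mul, ← map_smul, ← map_add]
    simp
  have hpos : ∀ p r, φ p < r → 0 < f (T p, 0) + r * f (0, 1) := by
    intro p r hr
    rw [← hsplit]
    simpa using hf _ ⟨(p, r), ⟨trivial, hr⟩, rfl⟩
  -- The separating hyperplane is not vertical: test it above the point 0, at a positive height.
  have hc : 0 < f (0, 1) := by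
    have h := hpos 0 (|φ 0| + 1) (by linarith [le_abs_self (φ 0)])
    have h0 : f ((0 : F), (0 : ℝ)) = 0 := f.map_zero
    rw [map_zero, h0, zero_add] at h
    exact pos_of_mul_pos_right h (by positivity)
  refine ⟨(f (0, 1))⁻¹ • f.comp (ContinuousLinearMap.inl ℝ F ℝ), fun p => ?_⟩
  refine le_of_forall_pos_le_add fun ε hε => ?_
  have h := mul_pos (inv_pos.2 hc) (hpos p (φ p + ε) (by linarith))
  have : (f (0, 1))⁻¹ * (f (T p, 0) + (φ p + ε) * f (0, 1))
      = φ p + (f (0, 1))⁻¹ * f (T p, 0) + ε := by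
    field_simp
    ring
  simp only [smul_apply, ContinuousLinearMap.comp_apply,
    ContinuousLinearMap.inl_apply, smul_eq_mul]
  linarith

/-- The function is quadratic: its convexity gap at `p`, `q` with weights `s`, `t` is `s * t` times
the pairing of `p - q` with itself. -/
theorem convexOn_pairing_sub {V : Submodule ℝ (X × StrongDual ℝ X)}
    (hV : ∀ p ∈ V, 0 ≤ p.2 p.1) (y : X) (z : StrongDual ℝ X) :
    ConvexOn ℝ Set.univ fun p : V =>
      (z - (p : X × StrongDual ℝ X).2) (y - (p : X × StrongDual ℝ X).1) := by
  refine ⟨convex_univ, fun p _ q _ s t hs ht hst => ?_⟩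
  have h := mul_nonneg (mul_nonneg hs ht) (hV _ (p - q).2)
  obtain rfl : t = 1 - s := by linarith
  simp only [Submodule.coe_sub, Submodule.coe_add, Submodule.coe_smul, Prod.fst_sub, Prod.snd_sub,
    Prod.fst_add, Prod.snd_add, Prod.smul_fst, Prod.smul_snd, sub_apply,
    add_apply, smul_apply, map_sub, map_add, map_smul,
    smul_eq_mul] at h ⊢
  nlinarith

/-- The sum of two maximal monotone linear relations whose domains have a closed difference contains
every point monotonically related to its graph. -/
theorem mem_add_of_monotonically_related [CompleteSpace X] {A₁ A₂ : X → Set (StrongDual ℝ X)}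
    (hA₁ : IsMaximalMonotone A₁) (hL₁ : IsLinearRelation A₁)
    (hA₂ : IsMaximalMonotone A₂) (hL₂ : IsLinearRelation A₂)
    (hclosed : IsClosed (dom A₁ - dom A₂)) {y : X} {z : StrongDual ℝ X}
    (h : ∀ p ∈ gra (A₁ + A₂), 0 ≤ (z - p.2) (y - p.1)) : z ∈ (A₁ + A₂) y := by
  obtain ⟨V₁, hV₁⟩ := hL₁
  obtain ⟨V₂, hV₂⟩ := hL₂
  have mem₁ : ∀ p, p ∈ V₁ ↔ p ∈ gra A₁ := fun p => by rw [← hV₁]; rfl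
  have mem₂ : ∀ p, p ∈ V₂ ↔ p ∈ gra A₂ := fun p => by rw [← hV₂]; rfl
  have nonneg₁ : ∀ p ∈ V₁, 0 ≤ p.2 p.1 := fun p hp => by
    simpa using hA₁.1 p ((mem₁ p).1 hp) 0 ((mem₁ 0).1 V₁.zero_mem)
  have nonneg₂ : ∀ p ∈ V₂, 0 ≤ p.2 p.1 := fun p hp => by
    simpa using hA₂.1 p ((mem₂ p).1 hp) 0 ((mem₂ 0).1 V₂.zero_mem)
  have : CompleteSpace V₁ :=
    (hV₁ ▸ hA₁.isClosed_gra : IsClosed (V₁ : Set (X × StrongDual ℝ X))).completeSpace_coe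
  have : CompleteSpace V₂ :=
    (hV₂ ▸ hA₂.isClosed_gra : IsClosed (V₂ : Set (X × StrongDual ℝ X))).completeSpace_coe
  let π₁ : V₁ × V₂ →L[ℝ] X × StrongDual ℝ X := V₁.subtypeL.comp (ContinuousLinearMap.fst ℝ V₁ V₂)
  let π₂ : V₁ × V₂ →L[ℝ] X × StrongDual ℝ X := V₂.subtypeL.comp (ContinuousLinearMap.snd ℝ V₁ V₂)
  let δ : X × X →L[ℝ] X := ContinuousLinearMap.fst ℝ X X - ContinuousLinearMap.snd ℝ X X
  let T : V₁ × V₂ →L[ℝ] X := δ.comp (((ContinuousLinearMap.fst ℝ X (StrongDual ℝ X)).comp π₁).prod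
    ((ContinuousLinearMap.fst ℝ X (StrongDual ℝ X)).comp π₂))
  have hrange : (T.range : Set X) = dom A₁ - dom A₂ := by
    ext d
    constructor
    · rintro ⟨p, rfl⟩
      exact Set.sub_mem_sub ⟨_, (mem₁ _).1 p.1.2⟩ ⟨_, (mem₂ _).1 p.2.2⟩
    · rintro ⟨a, ⟨a', ha⟩, b, ⟨b', hb⟩, rfl⟩
      exact ⟨(⟨(a, a'), (mem₁ _).2 ha⟩, ⟨(b, b'), (mem₂ _).2 hb⟩), rfl⟩
  -- Closedness of the domain difference makes the range a Banach space onto which `T` is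
  -- surjective.
  have : CompleteSpace T.range :=
    (hrange ▸ hclosed : IsClosed (T.range : Set X)).completeSpace_coe
  -- The provisional splitting `z = z + 0`; the multiplier will correct it.
  let φ : V₁ × V₂ → ℝ := fun p =>
    (z - (p.1 : X × StrongDual ℝ X).2) (y - (p.1 : X × StrongDual ℝ X).1) +
    (0 - (p.2 : X × StrongDual ℝ X).2) (y - (p.2 : X × StrongDual ℝ X).1)
  have hφcont : Continuous φ := by
    refine (continuous_dual_pairing.comp
      ((continuous_const.sub π₁.continuous : Continuous fun p => (y, z) - π₁ p))).add
      (continuous_dual_pairing.comp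
      ((continuous_const.sub π₂.continuous : Continuous fun p => (y, 0) - π₂ p)))
  have hφconv : ConvexOn ℝ Set.univ φ :=
    ((convexOn_pairing_sub nonneg₁ y z).comp_linearMap (LinearMap.fst ℝ V₁ V₂)).add
      ((convexOn_pairing_sub nonneg₂ y 0).comp_linearMap (LinearMap.snd ℝ V₁ V₂))
  have hφnonneg : ∀ p, T.rangeRestrict p = 0 → 0 ≤ φ p := by
    rintro ⟨⟨⟨a, a'⟩, ha⟩, ⟨⟨b, b'⟩, hb⟩⟩ hp
    have hab : a - b = 0 := congrArg Subtype.val hp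
    obtain rfl : a = b := sub_eq_zero.1 hab
    have := h (a, a' + b') (Set.add_mem_add ((mem₁ _).1 ha) ((mem₂ _).1 hb))
    simp only [φ, sub_apply, add_apply, zero_apply] at this ⊢
    linarith
  obtain ⟨μ, hμ⟩ := exists_multiplier (E := V₁ × V₂) (F := T.range) T.rangeRestrict
    (LinearMap.surjective_rangeRestrict T.toLinearMap) hφcont hφconv hφnonneg
  obtain ⟨l, hl, -⟩ := exists_extension_norm_eq T.range μ
  obtain ⟨h₁, h₂⟩ := hA₁.mem_and_mem_of_add_nonneg hA₂ (y₁ := y) (y₂ := y) (z₁ := z - l)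
    (z₂ := l) (by
      intro p hp q hq
      have := hμ (⟨p, (mem₁ _).2 hp⟩, ⟨q, (mem₂ _).2 hq⟩)
      rw [← hl] at this
      change 0 ≤ (z - p.2) (y - p.1) + (0 - q.2) (y - q.1) + l (p.1 - q.1) at this
      simp only [sub_apply, zero_apply, map_sub] at this ⊢
      linarith)
  exact ⟨_, h₁, _, h₂, by simp⟩

theorem isMonotoneOp_subdifferential {f : X → EReal} (hf : IsProperLscConvex f) :
    IsMonotoneOp (subdifferential f) := by
  -- A subgradient at a point of value `⊤` would force `f` to be `⊤` everywhere.
  have htop : ∀ p ∈ gra (subdifferential f), f p.1 ≠ ⊤ := by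
    intro p hp htop
    obtain ⟨x, hx⟩ := hf.proper
    have := hp x
    rw [htop, EReal.coe_add_top] at this
    exact hx.not_ge this
  intro p hp q hq
  have h₁ := hp q.1
  have h₂ := hq p.1
  lift f p.1 to ℝ using ⟨htop p hp, hf.ne_bot _⟩ with r
  lift f q.1 to ℝ using ⟨htop q hq, hf.ne_bot _⟩ with s
  norm_cast at h₁ h₂
  simp only [sub_apply, map_sub] at h₁ h₂ ⊢
  linarith

theorem IsSkew.pairing_sub_eq_zero {S : X → Set (StrongDual ℝ X)} (hS : IsSkew S)
    {p q : X × StrongDual ℝ X} (hp : p ∈ gra S) (hq : q ∈ gra S) :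
    (p.2 - q.2) (p.1 - q.1) = 0 := by
  obtain ⟨⟨V, hV⟩, h⟩ := hS
  rw [← hV] at hp hq h
  exact h _ (V.sub_mem hp hq)

theorem IsMonotoneOp.add_skew {A S : X → Set (StrongDual ℝ X)} (hA : IsMonotoneOp A)
    (hS : IsSkew S) : IsMonotoneOp (A + S) := by
  rintro ⟨x, _⟩ ⟨u, hu, s, hs, rfl⟩ ⟨y, _⟩ ⟨v, hv, t, ht, rfl⟩
  have h₁ := hA (x, u) hu (y, v) hv
  have h₂ := hS.pairing_sub_eq_zero (p := (x, s)) (q := (y, t)) hs ht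
  simp only [sub_apply, add_apply] at h₁ h₂ ⊢
  linarith

theorem IsLinearRelation.add {A B : X → Set (StrongDual ℝ X)} (hA : IsLinearRelation A)
    (hB : IsLinearRelation B) : IsLinearRelation (A + B) := by
  obtain ⟨V, hV⟩ := hA
  obtain ⟨W, hW⟩ := hB
  have memV : ∀ x u, u ∈ A x ↔ (x, u) ∈ V := fun x u => by
    rw [← SetLike.mem_coe, hV]; rfl
  have memW : ∀ x u, u ∈ B x ↔ (x, u) ∈ W := fun x u => by
    rw [← SetLike.mem_coe, hW]; rfl
  refine ⟨{ carrier := gra (A + B), zero_mem' := ?_, add_mem' := ?_, smul_mem' := ?_ }, rfl⟩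
  · rintro ⟨x, _⟩ ⟨y, _⟩ ⟨u, hu, s, hs, rfl⟩ ⟨v, hv, t, ht, rfl⟩
    exact ⟨u + v, (memV _ _).2 (V.add_mem ((memV _ _).1 hu) ((memV _ _).1 hv)),
      s + t, (memW _ _).2 (W.add_mem ((memW _ _).1 hs) ((memW _ _).1 ht)),
      add_add_add_comm _ _ _ _⟩
  · exact ⟨0, (memV _ _).2 V.zero_mem, 0, (memW _ _).2 W.zero_mem, add_zero _⟩
  · rintro c ⟨x, _⟩ ⟨u, hu, s, hs, rfl⟩
    exact ⟨c • u, (memV _ _).2 (V.smul_mem c ((memV _ _).1 hu)),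
      c • s, (memW _ _).2 (W.smul_mem c ((memW _ _).1 hs)), (smul_add _ _ _).symm⟩

theorem IsSkew.add {S T : X → Set (StrongDual ℝ X)} (hS : IsSkew S) (hT : IsSkew T) :
    IsSkew (S + T) := by
  refine ⟨hS.1.add hT.1, ?_⟩
  rintro ⟨x, _⟩ ⟨s, hs, t, ht, rfl⟩
  have h₁ := hS.2 (x, s) hs
  have h₂ := hT.2 (x, t) ht
  simp_all

theorem IsAtMostSingleValued.add {S T : X → Set (StrongDual ℝ X)} (hS : IsAtMostSingleValued S)
    (hT : IsAtMostSingleValued T) : IsAtMostSingleValued (S + T) := by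
  rintro x _ ⟨s, hs, t, ht, rfl⟩ _ ⟨s', hs', t', ht', rfl⟩
  rw [hS x hs hs', hT x ht ht']

theorem IsProperLscConvex.add {f g : X → EReal} (hf : IsProperLscConvex f)
    (hg : IsProperLscConvex g) (h : ∃ x, f x < ⊤ ∧ g x < ⊤) : IsProperLscConvex (f + g) where
  ne_bot x := by simp [EReal.add_eq_bot_iff, hf.ne_bot, hg.ne_bot]
  proper := by
    obtain ⟨x, hfx, hgx⟩ := h
    exact ⟨x, EReal.add_lt_top hfx.ne hgx.ne⟩
  -- Addition on `EReal` is discontinuous only where `⊤` meets `⊥`, and `⊥` is never attained.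
  lsc := hf.lsc.add' hg.lsc fun x =>
    EReal.continuousAt_add (Or.inr (hg.ne_bot x)) (Or.inl (hf.ne_bot x))
  convex x y a b ha hb hab := by
    refine (add_le_add (hf.convex x y a b ha hb hab) (hg.convex x y a b ha hb hab)).trans_eq ?_
    rw [Pi.add_apply, Pi.add_apply,
      EReal.left_distrib_of_nonneg_of_ne_top (EReal.coe_nonneg.2 ha.le) (EReal.coe_ne_top a),
      EReal.left_distrib_of_nonneg_of_ne_top (EReal.coe_nonneg.2 hb.le) (EReal.coe_ne_top b),
      add_add_add_comm]

theorem subdifferential_add_le (f g : X → EReal) (x : X) {u v : StrongDual ℝ X}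
    (hu : u ∈ subdifferential f x) (hv : v ∈ subdifferential g x) :
    u + v ∈ subdifferential (f + g) x := by
  intro y
  rw [add_apply, EReal.coe_add, Pi.add_apply, Pi.add_apply, add_add_add_comm]
  exact add_le_add (hu y) (hv y)

/-- A linear relation contains `(0, 0)`, so `∂f` is nonempty at 0. Thus 0 is a common point of
finiteness, making `f₁ + f₂` proper. -/
theorem IsBorweinWiersmaDecomposition.apply_zero_lt_top {A S : X → Set (StrongDual ℝ X)}
    {f : X → EReal} (hD : IsBorweinWiersmaDecomposition A f S) (hL : IsLinearRelation A) :
    f 0 < ⊤ := by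
  obtain ⟨V, hV⟩ := hL
  have h0 : (0 : X × StrongDual ℝ X) ∈ gra A := hV ▸ V.zero_mem
  rw [hD.eq_add] at h0
  obtain ⟨u, hu, -⟩ := h0
  obtain ⟨x, hx⟩ := hD.properLscConvex.proper
  refine lt_top_iff_ne_top.2 fun htop => ?_
  have := hu x
  rw [Prod.fst_zero, htop, EReal.coe_add_top] at this
  exact hx.not_ge this

end BorweinWiersma

open BorweinWiersma in
theorem proposition3p10 {X : Type*} [NormedAddCommGroup X] [NormedSpace ℝ X] [CompleteSpace X]
    (hX : BorweinWiersma.IsReflexiveSpace X)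
    (A₁ A₂ S₁ S₂ : X → Set (StrongDual ℝ X)) (f₁ f₂ : X → EReal)
    (hA₁ : BorweinWiersma.IsMaximalMonotone A₁) (hL₁ : BorweinWiersma.IsLinearRelation A₁)
    (hA₂ : BorweinWiersma.IsMaximalMonotone A₂) (hL₂ : BorweinWiersma.IsLinearRelation A₂)
    (hD₁ : BorweinWiersma.IsBorweinWiersmaDecomposition A₁ f₁ S₁)
    (hD₂ : BorweinWiersma.IsBorweinWiersmaDecomposition A₂ f₂ S₂)
    (hclosed : IsClosed (BorweinWiersma.dom A₁ - BorweinWiersma.dom A₂)) :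
    BorweinWiersma.IsBorweinWiersmaDecomposition (A₁ + A₂) (f₁ + f₂) (S₁ + S₂) := by
  have hf := hD₁.properLscConvex.add hD₂.properLscConvex
    ⟨0, hD₁.apply_zero_lt_top hL₁, hD₂.apply_zero_lt_top hL₂⟩
  have hS := hD₁.skew.add hD₂.skew
  refine ⟨hf, hS, hD₁.singleValued.add hD₂.singleValued, ?_⟩
  have hle : ∀ x, (A₁ + A₂) x ⊆ (subdifferential (f₁ + f₂) + (S₁ + S₂)) x := by
    rw [hD₁.eq_add, hD₂.eq_add]
    rintro x _ ⟨_, ⟨u, hu, s, hs, rfl⟩, _, ⟨v, hv, t, ht, rfl⟩, rfl⟩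
    exact ⟨u + v, subdifferential_add_le _ _ _ hu hv, s + t, Set.add_mem_add hs ht,
      add_add_add_comm _ _ _ _⟩
  funext x
  refine (hle x).antisymm fun z hz =>
    mem_add_of_monotonically_related hA₁ hL₁ hA₂ hL₂ hclosed fun p hp => ?_
  exact (isMonotoneOp_subdifferential hf).add_skew hS (x, z) hz p (hle _ hp)
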